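/- Let $U$ be a universal prefix machine on binary strings, $K_U(x\mid y)$ the conditional prefix complexity, $K_U(x)=K_U(x\mid\varepsilon)$, and write $I_{\mathrm{alg}}(x:y):=K_U(y)-K_U(y\mid x)$ for the algorithmic information that $x$ carries about $y$. An adaptation process $P$ is an effective system acting on configurations (control state, content of the execution substrate, content of the adaptation memory), the last two being binary strings. While it has not halted, it repeatedly applies a logically reversible (injective) operation, possibly followed by a logical erasure of one bit cell, i.e. an irreversible overwriting of that bit regardless of its value; which cell is erased does not depend on the bit that is lost. The written bit is $0$ for a reset to the standard state, but may also be supplied by the environment. $P$ is described by the source code of its one-step behaviour. For all constants $c_0,c_1\in\mathbb N$ there is a constant $c_U$, depending only on $U,c_0,c_1$, such that the following holds. Let $\sigma=\sigma(\mathcal C)$ be a binary string (the canonical descriptor of a task class $\mathcal C$), let $S_0$ be an initial state of the execution substrate that carries no information about $\sigma$, in the sense that $|K_U(\sigma\mid S_0)-K_U(\sigma)|\le c_0$, and let $\mathcal D$ be the adaptation input (initial content of the adaptation memory). Let $P$ be an adaptation process whose description $\mathrm{desc}(P)$ is of constant size relative to the input, $K_U(\mathrm{desc}(P)\mid \mathcal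 D)\le c_1$ (for instance a fixed process, or one whose source code is part of $\mathcal D$). If $P$, started on $(S_0,\mathcal D)$, can halt after exactly $H_{\mathrm{erase}}$ logical erasures in a configuration whose execution-substrate component is $S$, and $\mu:=I_{\mathrm{alg}}(S:\sigma)$, then $$H_{\mathrm{erase}}\;\ge\;\mu-I_{\mathrm{alg}}(\mathcal D:\sigma)-c_U .$$ -/

import Mathlib

/-- A conditional prefix machine: a partial recursive map `(program, condition) ↦ output` on binary
strings such that, for every condition, no halting program is a proper prefix of another one. -/
structure IsPrefixMachine (V : List Bool → List Bool →. List Bool) : Prop where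
  partrec : Partrec₂ V
  prefix_free : ∀ y p q, (V p y).Dom → (V q y).Dom → p <+: q → p = q

/-- A universal prefix machine: a prefix machine that produces every output of every other prefix
machine with a constant overhead in program length. -/
structure IsUniversalPrefixMachine (U : List Bool → List Bool →. List Bool) : Prop where
  isPrefixMachine : IsPrefixMachine U
  universal : ∀ V, IsPrefixMachine V →
    ∃ c : ℕ, ∀ p y x, x ∈ V p y → ∃ q, q.length ≤ p.length + c ∧ x ∈ U q y

/-- Conditional prefix complexity `K_U(x | y)`: the least length of a program that makes `U` output
`x` on condition `y`. (If `U` is universal, such a program always exists.) -/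
noncomputable def condK (U : List Bool → List Bool →. List Bool) (x y : List Bool) : ℕ :=
  sInf {n | ∃ p : List Bool, p.length = n ∧ x ∈ U p y}

/-- Prefix complexity `K_U(x)`: the condition is the empty string. -/
noncomputable def prefixK (U : List Bool → List Bool →. List Bool) (x : List Bool) : ℕ :=
  condK U x []

/-- Algorithmic mutual information `I(x : y) = K_U(y) - K_U(y | x)`, the information that `x`
carries about `y`. -/
noncomputable def algMutualInfo (U : List Bool → List Bool →. List Bool) (x y : List Bool) : ℤ :=
  (prefixK U y : ℤ) - (condK U y x : ℤ)

/-- A configuration of an adaptation process: the control state, the content of the execution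
substrate, the content of the adaptation memory. -/
abbrev Config : Type := ℕ × List Bool × List Bool

/-- The address of one bit cell: `Sum.inl i` is bit `i` of the execution substrate, `Sum.inr i` is
bit `i` of the adaptation memory. -/
abbrev Cell : Type := ℕ ⊕ ℕ

/-- The cell exists in the configuration. -/
def Config.HasCell (s : Config) : Cell → Prop
  | Sum.inl i => i < s.2.1.length
  | Sum.inr i => i < s.2.2.length

/-- Replace the content of a cell, whatever it was, by the bit `b`. -/
def Config.overwrite (s : Config) (k : Cell) (b : Bool) : Config :=
  match k with
  | Sum.inl i => (s.1, s.2.1.set i b, s.2.2)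
  | Sum.inr i => (s.1, s.2.1, s.2.2.set i b)

/-- An effective physical adaptation process. In a configuration that is not halted it performs the
logically reversible (injective) operation `next`; if `erased` then names a cell, a logical
erasure of that cell follows. Which cell is erased does not depend on the bit that is lost, so that
a step without erasure is injective and an erasure loses exactly one bit. Every irreversible
operation of the process is such an erasure. The substrates are allowed to coincide physically, so
cells of the execution substrate can be erased as well; all erasures are counted. The process is
given by a program `code` for its one-step behaviour. -/
structure AdaptationProcess where
  code : Nat.Partrec.Code
  halted : Config → Bool
  next : Config → Config
  erased : Config → Option Cell
  code_eval : ∀ s : Config, code.eval (Encodable.encode s) =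
    Part.some (Encodable.encode (halted s, next s, erased s))
  next_injOn : Set.InjOn next {s | halted s = false}
  erased_hasCell : ∀ s k, erased s = some k → s.HasCell k
  erased_overwrite : ∀ s k b, erased s = some k → erased (s.overwrite k b) = some k

/-- The description (source code) of a process, as a binary string. -/
def AdaptationProcess.desc (P : AdaptationProcess) : List Bool :=
  Nat.bits (Encodable.encode P.code)

/-- `P.Run s H t`: started in `s`, the process can halt in `t` after exactly `H` logical erasures.
An erasure overwrites the cell irrespective of its content. The new content `b` is `false` for a
reset to the standard state; a value supplied by the environment is also allowed, so the relation
covers all the physical outcomes of an irreversible bit operation. -/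
inductive AdaptationProcess.Run (P : AdaptationProcess) : Config → ℕ → Config → Prop
  | halt (s : Config) : P.halted s = true → P.Run s 0 s
  | reversible (s : Config) (H : ℕ) (t : Config) : P.halted s = false →
      P.erased (P.next s) = none → P.Run (P.next s) H t → P.Run s H t
  | erase (s : Config) (k : Cell) (b : Bool) (H : ℕ) (t : Config) : P.halted s = false →
      P.erased (P.next s) = some k → P.Run ((P.next s).overwrite k b) H t → P.Run s (H + 1) t

/-!
The chain rule gives `K(σ | D) ≤ K(S | D) + K(σ | S) + O(1)`, so it is enough to bound `K(S | D)` by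
the number of erasures. A run is determined by `desc P`, `S₀`, `D` and the bits written by the
erasures, and a simulation knows from the configuration when the next of these bits is needed, so
they form a self-delimiting program; the description costs `O(1)` bits given `D`.

It remains to supply `S₀` with `O(1)` bits, although `S₀` is arbitrary. Used as a clock, a late
string `y` shortens every sufficiently complex `σ`: the programs that halt before time `y`, or after
it, but later than some `M`, have a small total Kraft weight, so the Kraft–Chaitin theorem relative
to `y` recodes them by shorter ones. Hence `K(σ) ≤ K(σ | S₀) + c₀` confines `S₀` to a finite set,
unless `K(σ)` is bounded, in which case the inequality is trivial.
-/

open Nat.Partrec (Code)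

variable {α β γ : Type*} [Primcodable α] [Primcodable β] [Primcodable γ]

theorem exists_computable_approx {f : α →. β} (hf : Partrec f) :
    ∃ F : α → ℕ → Option β, Computable₂ F ∧ (∀ a, F a 0 = none) ∧
      (∀ {a m n b}, m ≤ n → b ∈ F a m → b ∈ F a n) ∧ ∀ a b, b ∈ f a ↔ ∃ n, b ∈ F a n := by
  obtain ⟨c, hc⟩ := Code.exists_code.1 hf
  have eval_encode (a : α) : c.eval (Encodable.encode a) = (f a).map Encodable.encode := by
    simp [hc]
  refine ⟨fun a n => (c.evaln n (Encodable.encode a)).bind Encodable.decode, ?_, ?_, ?_, ?_⟩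
  · have hrun : Computable fun z : α × ℕ => c.evaln z.2 (Encodable.encode z.1) :=
      Code.primrec_evaln.to_comp.comp
        ((Computable.snd.pair (Computable.const c)).pair (Computable.encode.comp Computable.fst))
    exact Computable.option_bind hrun (Computable.decode.comp Computable.snd).to₂
  · intro a
    simp [Code.evaln]
  · intro a m n b hmn hb
    obtain ⟨v, hv, hvb⟩ := Option.bind_eq_some_iff.1 hb
    exact Option.bind_eq_some_iff.2 ⟨v, Code.evaln_mono hmn hv, hvb⟩
  · intro a b
    constructor
    · intro hb
      have hv : Encodable.encode b ∈ c.eval (Encodable.encode a) :=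
        eval_encode a ▸ Part.mem_map _ hb
      obtain ⟨n, hn⟩ := Code.evaln_complete.1 hv
      exact ⟨n, Option.bind_eq_some_iff.2 ⟨_, hn, Encodable.encodek b⟩⟩
    · rintro ⟨n, hn⟩
      obtain ⟨v, hv, hvb⟩ := Option.bind_eq_some_iff.1 hn
      have hv' := Code.evaln_sound hv
      rw [eval_encode, Part.mem_map_iff] at hv'
      obtain ⟨b', hb', rfl⟩ := hv'
      rw [Encodable.encodek, Option.some.injEq] at hvb
      exact hvb ▸ hb'

theorem exists_partrec_selection {f : α → ℕ →. β} (hf : Partrec₂ f) :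
    ∃ h : α →. β, Partrec h ∧ (∀ a b, b ∈ h a → ∃ n, b ∈ f a n) ∧
      ∀ a n, (f a n).Dom → (h a).Dom := by
  obtain ⟨F, hF, -, -, hfF⟩ := exists_computable_approx hf
  refine ⟨fun a => Nat.rfindOpt fun k => F (a, k.unpair.1) k.unpair.2, Partrec.rfindOpt ?_, ?_, ?_⟩
  · have hk : Computable fun z : α × ℕ => z.2.unpair := Computable.unpair.comp Computable.snd
    exact hF.comp (Computable.fst.pair (Computable.fst.comp hk)) (Computable.snd.comp hk)
  · intro a b hb
    obtain ⟨k, hk⟩ := Nat.rfindOpt_spec hb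
    exact ⟨k.unpair.1, (hfF (a, _) b).2 ⟨_, hk⟩⟩
  · intro a n hn
    obtain ⟨b, hb⟩ := Part.dom_iff_mem.1 hn
    obtain ⟨t, ht⟩ := (hfF (a, n) b).1 hb
    exact Nat.rfindOpt_dom.2 ⟨Nat.pair n t, b, by rwa [Nat.unpair_pair]⟩

theorem exists_computable_enumeration_of_monotone {halted : α → ℕ → Bool}
    (hhalted : Computable₂ halted) (halted_zero : ∀ a, halted a 0 = false)
    (halted_mono : ∀ a, Monotone (halted a)) :
    ∃ e : ℕ → Option α, Computable e ∧ (∀ a, (∃ t, halted a t) ↔ ∃ n, e n = some a) ∧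
      ∀ m n a, e m = some a → e n = some a → m = n := by
  -- The index `Nat.pair (encode a) t` lists `a` if and only if `a` halts exactly at time `t + 1`.
  let e (n : ℕ) : Option α := (Encodable.decode₂ α n.unpair.1).bind fun a =>
    bif halted a (n.unpair.2 + 1) && !halted a n.unpair.2 then some a else none
  have e_eq_some (n : ℕ) (a : α) : e n = some a ↔ n.unpair.1 = Encodable.encode a ∧
      halted a (n.unpair.2 + 1) ∧ ¬ halted a n.unpair.2 := by
    simp only [e, Option.bind_eq_some_iff, Encodable.decode₂_eq_some, cond_eq_ite,
      Bool.and_eq_true, Bool.not_eq_true', Option.ite_none_right_eq_some, Option.some.injEq,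
      Bool.not_eq_true]
    grind
  refine ⟨e, ?_, fun a => ⟨fun h => ?_, ?_⟩, fun m n a hm hn => ?_⟩
  · have ht : Computable fun z : ℕ × α => z.1.unpair.2 :=
      Computable.snd.comp (Computable.unpair.comp Computable.fst)
    exact Computable.option_bind
      (Primrec.decode₂.to_comp.comp (Computable.fst.comp Computable.unpair))
      (Computable.cond (Primrec.and.to_comp.comp
        (hhalted.comp Computable.snd (Computable.succ.comp ht))
        (Primrec.not.to_comp.comp (hhalted.comp Computable.snd ht)))
        (Computable.option_some.comp Computable.snd) (Computable.const none)).to₂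
  · obtain ⟨t, ht⟩ := Nat.exists_eq_add_one_of_ne_zero fun h0 : Nat.find h = 0 => by
      simpa [h0, halted_zero] using Nat.find_spec h
    refine ⟨Nat.pair (Encodable.encode a) t, (e_eq_some _ _).2 ?_⟩
    rw [Nat.unpair_pair]
    exact ⟨rfl, ht ▸ Nat.find_spec h, Nat.find_min h (by omega)⟩
  · rintro ⟨n, hn⟩
    exact ⟨_, ((e_eq_some n a).1 hn).2.1⟩
  · obtain ⟨hma, hm1, hm0⟩ := (e_eq_some m a).1 hm
    obtain ⟨hna, hn1, hn0⟩ := (e_eq_some n a).1 hn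
    have htime : m.unpair.2 = n.unpair.2 := le_antisymm
      (not_lt.1 fun h => hm0 (halted_mono a h hn1)) (not_lt.1 fun h => hn0 (halted_mono a h hm1))
    rw [← Nat.pair_unpair m, ← Nat.pair_unpair n, hma, hna, htime]

theorem exists_computable_enumeration {f : α →. β} (hf : Partrec f) :
    ∃ e : ℕ → Option α, Computable e ∧ (∀ a, (f a).Dom ↔ ∃ n, e n = some a) ∧
      ∀ m n a, e m = some a → e n = some a → m = n := by
  obtain ⟨F, hF, hF_zero, hF_mono, hfF⟩ := exists_computable_approx hf
  have hmono (a : α) : Monotone fun t => (F a t).isSome := fun s t hst hs => by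
    obtain ⟨b, hb⟩ := Option.isSome_iff_exists.1 hs
    exact Option.isSome_iff_exists.2 ⟨b, hF_mono hst hb⟩
  have dom_iff (a : α) : (f a).Dom ↔ ∃ t, (F a t).isSome := by
    simp only [Part.dom_iff_mem, hfF, Option.isSome_iff_exists, Option.mem_def]
    exact exists_comm
  obtain ⟨e, he, hlist, hinj⟩ := exists_computable_enumeration_of_monotone
    (halted := fun a t => (F a t).isSome) (Primrec.option_isSome.to_comp.comp hF)
    (fun a => by rw [hF_zero, Option.isSome_none]) hmono
  exact ⟨e, he, fun a => (dom_iff a).trans (hlist a), hinj⟩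

/-! ### Self-delimiting machines -/

/-- A prefix machine with conditions and outputs in arbitrary types. It plays the role of
`IsPrefixMachine` for intermediate machines, whose conditions need not be strings. -/
structure IsSelfDelimiting (V : List Bool → α →. β) : Prop where
  partrec : Partrec₂ V
  prefix_free : ∀ a p q, (V p a).Dom → (V q a).Dom → p <+: q → p = q

theorem IsPrefixMachine.isSelfDelimiting {V : List Bool → List Bool →. List Bool}
    (hV : IsPrefixMachine V) : IsSelfDelimiting V :=
  ⟨hV.partrec, hV.prefix_free⟩

theorem IsSelfDelimiting.isPrefixMachine {V : List Bool → List Bool →. List Bool}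
    (hV : IsSelfDelimiting V) : IsPrefixMachine V :=
  ⟨hV.partrec, hV.prefix_free⟩

namespace IsSelfDelimiting

variable {V : List Bool → α →. β}

theorem comap (hV : IsSelfDelimiting V) {f : γ →. α} (hf : Partrec f) :
    IsSelfDelimiting fun p c => (f c).bind (V p) where
  partrec := (hf.comp Computable.snd).bind
    (hV.partrec.comp (Computable.fst.comp Computable.fst) Computable.snd)
  prefix_free _ p q := fun ⟨_, hp⟩ ⟨_, hq⟩ => hV.prefix_free _ p q hp hq

theorem bind (hV : IsSelfDelimiting V) {f : α → β →. γ} (hf : Partrec₂ f) :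
    IsSelfDelimiting fun p a => (V p a).bind (f a) where
  partrec := Partrec.bind hV.partrec
    (hf.comp (Computable.snd.comp Computable.fst) Computable.snd)
  prefix_free a p q hp hq := hV.prefix_free a p q hp.1 hq.1

theorem eq_of_prefix_of_prefix (hV : IsSelfDelimiting V) {a : α} {p q x : List Bool}
    (hp : (V p a).Dom) (hq : (V q a).Dom) (hpx : p <+: x) (hqx : q <+: x) : p = q :=
  (List.prefix_or_prefix_of_prefix hpx hqx).elim (hV.prefix_free a p q hp hq)
    fun h => (hV.prefix_free a q p hq hp h).symm

theorem exists_comp (hV : IsSelfDelimiting V) {W : List Bool → β →. γ} (hW : IsSelfDelimiting W) :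
    ∃ X : List Bool → α →. γ, IsSelfDelimiting X ∧
      ∀ {p q a b c}, b ∈ V p a → c ∈ W q b → c ∈ X (p ++ q) a := by
  let run (z : List Bool × α) (n : ℕ) : Part γ := (V (z.1.take n) z.2).bind (W (z.1.drop n))
  have hrun : Partrec₂ run := by
    have htake : Computable fun y : (List Bool × α) × ℕ => y.1.1.take y.2 :=
      Primrec.list_take.to_comp.comp Computable.snd (Computable.fst.comp Computable.fst)
    have hdrop : Computable fun y : ((List Bool × α) × ℕ) × β => y.1.1.1.drop y.1.2 :=
      Primrec.list_drop.to_comp.comp (Computable.snd.comp Computable.fst)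
        (Computable.fst.comp (Computable.fst.comp Computable.fst))
    exact Partrec.bind (hV.partrec.comp htake (Computable.snd.comp Computable.fst))
      (hW.partrec.comp hdrop Computable.snd)
  obtain ⟨h, hpartrec, hsound, hdom⟩ := exists_partrec_selection hrun
  have split {x a c} (hc : c ∈ h (x, a)) : ∃ p q b, x = p ++ q ∧ b ∈ V p a ∧ c ∈ W q b := by
    obtain ⟨n, hn⟩ := hsound _ _ hc
    obtain ⟨b, hb, hc⟩ := Part.mem_bind_iff.1 hn
    exact ⟨_, _, b, (List.take_append_drop n x).symm, hb, hc⟩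
  refine ⟨fun x a => h (x, a), ⟨hpartrec, fun a x x' hx hx' hxx' => ?_⟩, ?_⟩
  · obtain ⟨c, hc⟩ := Part.dom_iff_mem.1 hx
    obtain ⟨c', hc'⟩ := Part.dom_iff_mem.1 hx'
    obtain ⟨p, q, b, rfl, hb, hc⟩ := split hc
    obtain ⟨p', q', b', rfl, hb', hc'⟩ := split hc'
    obtain rfl := hV.eq_of_prefix_of_prefix hb.1 hb'.1
      ((List.prefix_append _ _).trans hxx') (List.prefix_append _ _)
    obtain rfl := Part.mem_unique hb hb'
    rw [hW.prefix_free b q q' hc.1 hc'.1 ((List.prefix_append_right_inj p).1 hxx')]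
  · intro p q a b c hb hc
    have hpq : c ∈ run (p ++ q, a) p.length :=
      Part.mem_bind_iff.2 ⟨b, by rwa [List.take_left], by rwa [List.drop_left]⟩
    obtain ⟨c', hc'⟩ := Part.dom_iff_mem.1 (hdom _ _ (Part.dom_iff_mem.2 ⟨c, hpq⟩))
    obtain ⟨p', q', b', hx, hb', hcb'⟩ := split hc'
    obtain rfl := hV.eq_of_prefix_of_prefix hb.1 hb'.1 (List.prefix_append p q)
      (hx ▸ List.prefix_append _ _)
    obtain rfl := List.append_cancel_left hx
    obtain rfl := Part.mem_unique hb hb'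
    obtain rfl := Part.mem_unique hc hcb'
    exact hc'

end IsSelfDelimiting

/-- The machine with the programs `0ⁿ1`, each of which outputs `n`: a self-delimiting header. -/
def unaryMachine (p : List Bool) : Option ℕ :=
  bif p.idxOf true + 1 == p.length then some (p.idxOf true) else none

theorem mem_unaryMachine {p : List Bool} {n : ℕ} :
    n ∈ unaryMachine p ↔ p.idxOf true = n ∧ p.length = n + 1 := by
  rw [unaryMachine, Option.mem_def, cond_eq_ite, Option.ite_none_right_eq_some,
    Option.some.injEq, beq_iff_eq]
  omega

theorem isSelfDelimiting_unaryMachine :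
    IsSelfDelimiting fun p (_ : α) => (unaryMachine p : Part ℕ) where
  partrec := by
    have hidx : Computable fun p : List Bool => p.idxOf true :=
      Primrec.list_idxOf.to_comp.comp (Computable.const true) Computable.id
    have hmachine : Computable unaryMachine := Computable.cond
      (Primrec.beq.to_comp.comp (Computable.succ.comp hidx) Computable.list_length)
      (Computable.option_some.comp hidx) (Computable.const none)
    exact Computable.ofOption (hmachine.comp Computable.fst)
  prefix_free _ p q hp hq hpq := by
    obtain ⟨m, hm⟩ := Part.dom_iff_mem.1 hp
    obtain ⟨n, hn⟩ := Part.dom_iff_mem.1 hq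
    rw [Part.mem_coe, mem_unaryMachine] at hm hn
    obtain ⟨r, rfl⟩ := hpq
    have hmem : true ∈ p := List.idxOf_lt_length_iff.1 (by omega)
    rw [List.idxOf_append_of_mem hmem] at hn
    exact (List.prefix_append p r).eq_of_length (by omega)

theorem exists_mem_unaryMachine (n : ℕ) : ∃ p : List Bool, p.length = n + 1 ∧ n ∈ unaryMachine p :=
  ⟨List.replicate n false ++ [true], by simp, mem_unaryMachine.2
    ⟨by rw [List.idxOf_append_of_notMem (by simp)]; simp, by simp⟩⟩

/-! ### Kraft's inequality and Kraft–Chaitin coding -/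

/-- The Kraft weight `2⁻ⁿ` of a codeword length `n`, or `0` if there is no codeword. -/
noncomputable def kraftWeight (o : Option ℕ) : ℝ :=
  o.elim 0 fun n => (1 / 2) ^ n

theorem kraftWeight_nonneg (o : Option ℕ) : 0 ≤ kraftWeight o := by
  cases o <;> simp [kraftWeight]

theorem uniquelyDecodable_of_prefix_free {δ : Type*} {S : Set (List δ)}
    (hS : ∀ p ∈ S, ∀ q ∈ S, p <+: q → p = q) (h_nil : [] ∉ S) :
    InformationTheory.UniquelyDecodable S := by
  have flatten_ne_nil {a : List δ} (ha : a ∈ S) (L : List (List δ)) : (a :: L).flatten ≠ [] :=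
    fun h => h_nil ((List.append_eq_nil_iff.1 h).1 ▸ ha)
  intro L₁
  induction L₁ with
  | nil =>
    rintro (_ | ⟨b, L₂⟩) _ h₂ h
    · rfl
    · exact absurd h.symm (flatten_ne_nil (h₂ b List.mem_cons_self) L₂)
  | cons a L₁ ih =>
    rintro (_ | ⟨b, L₂⟩) h₁ h₂ h
    · exact absurd h (flatten_ne_nil (h₁ a List.mem_cons_self) L₁)
    · rw [List.forall_mem_cons] at h₁ h₂
      simp only [List.flatten_cons] at h
      obtain rfl : a = b :=
        (List.prefix_or_prefix_of_prefix ⟨_, h⟩ (List.prefix_append b _)).elim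
          (hS a h₁.1 b h₂.1) fun hba => (hS b h₂.1 a h₁.1 hba).symm
      rw [ih L₂ h₁.2 h₂.2 (List.append_cancel_left h)]

theorem sum_kraftWeight_le_one_of_prefix_free {T : Finset (List Bool)}
    (hT : ∀ p ∈ T, ∀ q ∈ T, p <+: q → p = q) :
    ∑ p ∈ T, kraftWeight (some p.length) ≤ 1 := by
  by_cases h_nil : [] ∈ T
  · have hsub : T ⊆ {[]} := fun p hp =>
      Finset.mem_singleton.2 (hT [] h_nil p hp List.nil_prefix).symm
    exact (Finset.sum_le_sum_of_subset_of_nonneg hsub fun _ _ _ => kraftWeight_nonneg _).trans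
      (by simp [kraftWeight])
  · have hdec := uniquelyDecodable_of_prefix_free (S := (T : Set (List Bool)))
      (by simpa only [Finset.mem_coe] using hT) (by simpa only [Finset.mem_coe] using h_nil)
    simpa [kraftWeight] using InformationTheory.kraft_mcmillan_inequality hdec

theorem summable_kraftWeight {e : ℕ → Option (List Bool)}
    (hinj : ∀ m n p, e m = some p → e n = some p → m = n)
    (hprefix : ∀ m n p q, e m = some p → e n = some q → p <+: q → p = q) :
    Summable fun n => kraftWeight ((e n).map List.length) := by
  refine summable_of_sum_le (c := 1) (fun n => kraftWeight_nonneg _) fun u => ?_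
  have hinjOn : Set.InjOn (fun n => (e n).getD []) ({n ∈ u | (e n).isSome} : Finset ℕ) := by
    intro m hm n hn hmn
    obtain ⟨p, hp⟩ := Option.isSome_iff_exists.1 (Finset.mem_filter.1 hm).2
    obtain ⟨q, hq⟩ := Option.isSome_iff_exists.1 (Finset.mem_filter.1 hn).2
    simp only [hp, hq, Option.getD_some] at hmn
    exact hinj m n p hp (hmn ▸ hq)
  calc ∑ n ∈ u, kraftWeight ((e n).map List.length)
      = ∑ n ∈ u with (e n).isSome, kraftWeight (some ((e n).getD []).length) := by
        rw [Finset.sum_filter]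
        refine Finset.sum_congr rfl fun n _ => ?_
        rcases e n with _ | p <;> simp [kraftWeight]
    _ = ∑ p ∈ ({n ∈ u | (e n).isSome} : Finset ℕ).image fun n => (e n).getD [],
          kraftWeight (some p.length) := by
        rw [Finset.sum_image hinjOn]
    _ ≤ 1 := sum_kraftWeight_le_one_of_prefix_free fun p hp q hq => by
        simp only [Finset.mem_image, Finset.mem_filter, Option.isSome_iff_exists] at hp hq
        obtain ⟨m, ⟨_, a, ha⟩, rfl⟩ := hp
        obtain ⟨n, ⟨_, b, hb⟩, rfl⟩ := hq
        simpa only [ha, hb, Option.getD_some] using hprefix m n a b ha hb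

theorem exists_sum_le_of_summable {f : ℕ → ℝ} (hf : Summable f) {ε : ℝ} (hε : 0 < ε) :
    ∃ M : ℕ, ∀ u : Finset ℕ, (∀ n ∈ u, M ≤ n) → ∑ n ∈ u, f n ≤ ε := by
  obtain ⟨s, hs⟩ := summable_iff_vanishing_norm.1 hf ε hε
  obtain ⟨M, hM⟩ := s.exists_nat_subset_range
  refine ⟨M, fun u hu => (le_abs_self _).trans (hs u ?_).le⟩
  exact Finset.disjoint_left.2 fun n hn hns =>
    (Finset.mem_range.1 (hM hns)).not_ge (hu n hn)

/-- The number with the binary digits `d`, least significant digit first. -/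
def natOfBits (d : List Bool) : ℕ := Nat.ofDigits 2 (d.map Bool.toNat)

theorem natOfBits_bits (n : ℕ) : natOfBits n.bits = n := by
  have h : n.bits.map Bool.toNat = Nat.digits 2 n := (Nat.digits_two_eq_bits n).symm
  rw [natOfBits, h, Nat.ofDigits_digits]

theorem natOfBits_append (d d' : List Bool) :
    natOfBits (d ++ d') = natOfBits d + 2 ^ d.length * natOfBits d' := by
  simp [natOfBits, Nat.ofDigits_append]

theorem natOfBits_lt (d : List Bool) : natOfBits d < 2 ^ d.length := by
  have h := Nat.ofDigits_lt_base_pow_length (b := 2) (l := d.map Bool.toNat) one_lt_two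
    (by simpa only [List.forall_mem_map] using fun b _ => Bool.toNat_lt b)
  rwa [List.length_map] at h

theorem exists_natOfBits_eq {n s : ℕ} (hs : s < 2 ^ n) :
    ∃ d : List Bool, d.length = n ∧ natOfBits d = s := by
  induction n generalizing s with
  | zero => exact ⟨[], rfl, by simp_all [natOfBits]⟩
  | succ n ih =>
    obtain ⟨d, hd, hs'⟩ := ih (s := s / 2) (by omega)
    refine ⟨(s.testBit 0) :: d, by rw [List.length_cons, hd], ?_⟩
    rw [natOfBits] at hs'
    rw [natOfBits, List.map_cons, Nat.ofDigits_cons, hs', Nat.toNat_testBit, pow_zero, Nat.div_one]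
    exact Nat.mod_add_div s 2

theorem computable_natOfBits : Computable natOfBits := by
  have hdigit : Primrec fun b : Bool => b.toNat := Primrec.dom_finite _
  have hfoldr : Primrec fun d : List Bool => d.foldr (fun b n => b.toNat + 2 * n) 0 :=
    Primrec.list_foldr Primrec.id (Primrec.const 0) <| .to₂ <| Primrec.nat_add.comp
      (hdigit.comp (Primrec.fst.comp Primrec.snd))
      (Primrec.nat_mul.comp (Primrec.const 2) (Primrec.snd.comp Primrec.snd))
  refine hfoldr.to_comp.of_eq fun d => ?_
  simp only [natOfBits, Nat.ofDigits_eq_foldr, List.foldr_map, Nat.cast_id]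

/-- The interval of the numbers in `[0, 1)` whose binary expansion starts with `q`. -/
def cylinder (q : List Bool) : Set ℝ :=
  Set.Ico (natOfBits q.reverse / 2 ^ q.length) ((natOfBits q.reverse + 1) / 2 ^ q.length)

theorem cylinder_nonempty (q : List Bool) : (cylinder q).Nonempty :=
  Set.nonempty_Ico.2 (by gcongr; linarith)

theorem cylinder_subset_of_prefix {q q' : List Bool} (h : q <+: q') :
    cylinder q' ⊆ cylinder q := by
  obtain ⟨r, rfl⟩ := h
  have hr : (natOfBits r.reverse : ℝ) + 1 ≤ 2 ^ r.length := by
    exact_mod_cast r.length_reverse ▸ natOfBits_lt r.reverse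
  rw [cylinder, cylinder, List.reverse_append, natOfBits_append, List.length_append,
    List.length_reverse, pow_add]
  push_cast
  apply Set.Ico_subset_Ico
  · rw [div_le_div_iff₀ (by positivity) (by positivity)]
    nlinarith [(natOfBits r.reverse).cast_nonneg (α := ℝ), pow_pos (two_pos (α := ℝ)) q.length]
  · rw [div_le_div_iff₀ (by positivity) (by positivity)]
    nlinarith [pow_pos (two_pos (α := ℝ)) q.length]

/-- The Kraft sum of the first `i` requests of a sequence `ℓ` of codeword lengths. -/
noncomputable def kraftSum (ℓ : ℕ → Option ℕ) (i : ℕ) : ℝ :=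
  ∑ j ∈ Finset.range i, kraftWeight (ℓ j)

/-- The index of the codeword of length `n` for request `i` in the Shannon–Fano–Elias code of `ℓ`.
Request `i` owns the interval from `2 * kraftSum ℓ i` to `2 * kraftSum ℓ (i + 1)`. Its length is
twice `2⁻ⁿ`, so it contains the second dyadic interval of length `2⁻ⁿ` that meets it. -/
noncomputable def codeIndex (ℓ : ℕ → Option ℕ) (i n : ℕ) : ℕ :=
  ⌊2 * kraftSum ℓ i * 2 ^ n⌋₊ + 1

/-- The string `q` is the codeword of request `i` in the Shannon–Fano–Elias code of `ℓ`. -/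
def IsCodeword (ℓ : ℕ → Option ℕ) (q : List Bool) (i : ℕ) : Prop :=
  ℓ i = some q.length ∧ codeIndex ℓ i q.length = natOfBits q.reverse

section Codeword

variable {ℓ : ℕ → Option ℕ}

theorem monotone_kraftSum : Monotone (kraftSum ℓ) :=
  fun _ _ hij => Finset.sum_le_sum_of_subset_of_nonneg (Finset.range_mono hij)
    fun _ _ _ => kraftWeight_nonneg _

theorem two_mul_kraftSum_le_codeIndex_div (i n : ℕ) :
    2 * kraftSum ℓ i ≤ codeIndex ℓ i n / 2 ^ n := by
  have h := Nat.lt_floor_add_one (2 * kraftSum ℓ i * 2 ^ n)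
  rw [le_div_iff₀ (by positivity), codeIndex]
  push_cast
  linarith

theorem codeIndex_add_one_div_le {i n : ℕ} (hi : ℓ i = some n) :
    ((codeIndex ℓ i n : ℝ) + 1) / 2 ^ n ≤ 2 * kraftSum ℓ (i + 1) := by
  have hweight : kraftWeight (some n) * 2 ^ n = 1 := by simp [kraftWeight]
  have hsum : kraftSum ℓ (i + 1) = kraftSum ℓ i + kraftWeight (some n) := by
    rw [kraftSum, Finset.sum_range_succ, hi, kraftSum]
  have hnonneg : 0 ≤ kraftSum ℓ i := Finset.sum_nonneg fun _ _ => kraftWeight_nonneg _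
  have h := Nat.floor_le (a := 2 * kraftSum ℓ i * 2 ^ n) (by positivity)
  rw [div_le_iff₀ (by positivity), codeIndex, hsum]
  push_cast
  linarith

theorem IsCodeword.cylinder_subset {q : List Bool} {i : ℕ} (h : IsCodeword ℓ q i) :
    cylinder q ⊆ Set.Ico (2 * kraftSum ℓ i) (2 * kraftSum ℓ (i + 1)) := by
  rw [cylinder, ← h.2]
  exact Set.Ico_subset_Ico (two_mul_kraftSum_le_codeIndex_div _ _) (codeIndex_add_one_div_le h.1)

theorem IsCodeword.index_eq_of_prefix {q q' : List Bool} {i i' : ℕ} (h : IsCodeword ℓ q i)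
    (h' : IsCodeword ℓ q' i') (hq : q <+: q') : i = i' := by
  have hmono : Monotone fun i => 2 * kraftSum ℓ i := monotone_kraftSum.const_mul zero_le_two
  by_contra hne
  obtain ⟨x, hx⟩ := cylinder_nonempty q'
  exact Set.disjoint_left.1 (hmono.pairwise_disjoint_on_Ico_succ hne)
    (h.cylinder_subset (cylinder_subset_of_prefix hq hx)) (h'.cylinder_subset hx)

theorem exists_isCodeword {i n : ℕ} (hi : ℓ i = some n) (hsum : 2 * kraftSum ℓ (i + 1) ≤ 1) :
    ∃ q : List Bool, q.length = n ∧ IsCodeword ℓ q i := by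
  have hlt : codeIndex ℓ i n < 2 ^ n := by
    have h := (codeIndex_add_one_div_le hi).trans hsum
    rw [div_le_one (by positivity)] at h
    exact_mod_cast h
  obtain ⟨d, rfl, hd⟩ := exists_natOfBits_eq hlt
  refine ⟨d.reverse, d.length_reverse, ?_⟩
  rw [IsCodeword, List.length_reverse, List.reverse_reverse]
  exact ⟨hi, hd.symm⟩

/-- The sum of `A / 2 ^ l` and `1 / 2 ^ n`, where the pair `(A, l)` encodes `A / 2 ^ l`. -/
def addKraftWeight (s : ℕ × ℕ) (n : ℕ) : ℕ × ℕ :=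
  (s.1 * 2 ^ n + 2 ^ s.2, s.2 + n)

/-- `kraftSum ℓ i` as a fraction `A / 2 ^ l`, encoded by the pair `(A, l)`. -/
def kraftSumFraction (ℓ : ℕ → Option ℕ) (i : ℕ) : ℕ × ℕ :=
  i.rec (0, 0) fun j s => (ℓ j).elim s (addKraftWeight s)

theorem kraftSum_eq_div (i : ℕ) :
    kraftSum ℓ i = (kraftSumFraction ℓ i).1 / 2 ^ (kraftSumFraction ℓ i).2 := by
  induction i with
  | zero => simp [kraftSum, kraftSumFraction]
  | succ i ih =>
    have hsucc : kraftSumFraction ℓ (i + 1) =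
      (ℓ i).elim (kraftSumFraction ℓ i) (addKraftWeight (kraftSumFraction ℓ i)) := rfl
    rw [kraftSum] at ih
    rw [kraftSum, Finset.sum_range_succ, ih, hsucc]
    rcases ℓ i with _ | n
    · simp [kraftWeight]
    · simp only [kraftWeight, addKraftWeight, Option.elim_some, one_div, inv_pow]
      push_cast
      rw [pow_add]
      field_simp

theorem codeIndex_eq_div (i n : ℕ) : codeIndex ℓ i n =
    2 * (kraftSumFraction ℓ i).1 * 2 ^ n / 2 ^ (kraftSumFraction ℓ i).2 + 1 := by
  rw [codeIndex, kraftSum_eq_div, ← Nat.floor_div_eq_div (K := ℝ)]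
  push_cast
  rw [mul_div_assoc', div_mul_eq_mul_div]

end Codeword

theorem computable_pow {m n : α → ℕ} (hm : Computable m) (hn : Computable n) :
    Computable fun a => m a ^ n a :=
  (Primrec₂.unpaired'.1 Nat.Primrec.pow).to_comp.comp hm hn

theorem computable_addKraftWeight : Computable₂ addKraftWeight := by
  have hl : Computable fun z : (ℕ × ℕ) × ℕ => z.1.2 := Computable.snd.comp Computable.fst
  have hA : Computable fun z : (ℕ × ℕ) × ℕ => z.1.1 * 2 ^ z.2 :=
    Primrec.nat_mul.to_comp.comp (Computable.fst.comp Computable.fst)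
      (computable_pow (Computable.const 2) Computable.snd)
  exact (Primrec.nat_add.to_comp.comp hA (computable_pow (Computable.const 2) hl)).pair
    (Primrec.nat_add.to_comp.comp hl Computable.snd)

theorem computable_kraftSumFraction {ℓ : α → ℕ → Option ℕ} (hℓ : Computable₂ ℓ) :
    Computable₂ fun a i => kraftSumFraction (ℓ a) i := by
  let next (z : α × ℕ) (js : ℕ × ℕ × ℕ) : ℕ × ℕ :=
    (ℓ z.1 js.1).elim js.2 (addKraftWeight js.2)
  have hnext : Computable₂ next := by
    have hℓ' : Computable fun y : (α × ℕ) × ℕ × ℕ × ℕ => ℓ y.1.1 y.2.1 :=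
      hℓ.comp (Computable.fst.comp Computable.fst) (Computable.fst.comp Computable.snd)
    have hadd : Computable fun y : ((α × ℕ) × ℕ × ℕ × ℕ) × ℕ => addKraftWeight y.1.2.2 y.2 :=
      computable_addKraftWeight.comp
        (Computable.snd.comp (Computable.snd.comp Computable.fst)) Computable.snd
    refine (Computable.option_casesOn hℓ' (Computable.snd.comp Computable.snd) hadd.to₂).of_eq
      fun y => ?_
    cases h : ℓ y.1.1 y.2.1 <;> simp only [next, h, Option.elim_none, Option.elim_some]
  exact Computable.nat_rec Computable.snd (Computable.const (0, 0)) hnext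

theorem computable_codeIndex {ℓ : α → ℕ → Option ℕ} {i n : α → ℕ} (hℓ : Computable₂ ℓ)
    (hi : Computable i) (hn : Computable n) : Computable fun a => codeIndex (ℓ a) (i a) (n a) := by
  have hfraction : Computable fun a => kraftSumFraction (ℓ a) (i a) :=
    (computable_kraftSumFraction hℓ).comp Computable.id hi
  have hmul : Computable₂ fun y n : ℕ => y * n := Primrec.nat_mul.to_comp
  have hpow {n : α → ℕ} (hn : Computable n) : Computable fun a => 2 ^ n a :=
    computable_pow (Computable.const 2) hn
  have hnum : Computable fun a => 2 * (kraftSumFraction (ℓ a) (i a)).1 * 2 ^ n a :=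
    hmul.comp (hmul.comp (Computable.const 2) (Computable.fst.comp hfraction)) (hpow hn)
  exact (Computable.succ.comp (Primrec.nat_div.to_comp.comp hnum
    (hpow (Computable.snd.comp hfraction)))).of_eq fun a => (codeIndex_eq_div _ _).symm

/-- The output of request `i`, if `q` is its codeword. A request `(n, b)` asks for a codeword of
length `n` for the output `b`. -/
noncomputable def codewordOutput (g : ℕ → Option (ℕ × β)) (q : List Bool) (i : ℕ) : Option β :=
  (g i).bind fun r =>
    bif r.1 == q.length && codeIndex (fun j => (g j).map Prod.fst) i q.length ==
      natOfBits q.reverse then some r.2 else none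

theorem mem_codewordOutput {δ : Type*} {g : ℕ → Option (ℕ × δ)} {q : List Bool} {i : ℕ} {b : δ} :
    b ∈ codewordOutput g q i ↔
      g i = some (q.length, b) ∧ IsCodeword (fun j => (g j).map Prod.fst) q i := by
  simp only [codewordOutput, Option.mem_def, Option.bind_eq_some_iff, cond_eq_ite,
    Bool.and_eq_true, beq_iff_eq, Option.ite_none_right_eq_some, Option.some.injEq, Prod.exists,
    IsCodeword, Option.map_eq_some_iff]
  grind

theorem mem_rfindOpt_codewordOutput {δ : Type*} {g : ℕ → Option (ℕ × δ)} {q : List Bool} {b : δ} :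
    b ∈ Nat.rfindOpt (codewordOutput g q) ↔
      ∃ i, g i = some (q.length, b) ∧ IsCodeword (fun j => (g j).map Prod.fst) q i := by
  refine ⟨fun hb => (Nat.rfindOpt_spec hb).imp fun i => mem_codewordOutput.1, ?_⟩
  rintro ⟨i, hg, hq⟩
  have hdom := Nat.rfindOpt_dom.2 ⟨i, b, mem_codewordOutput.2 ⟨hg, hq⟩⟩
  obtain ⟨b', hb'⟩ := Part.dom_iff_mem.1 hdom
  obtain ⟨i', hi'⟩ := Nat.rfindOpt_spec hb'
  obtain ⟨hg', hq'⟩ := mem_codewordOutput.1 hi'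
  obtain rfl := hq.index_eq_of_prefix hq' List.prefix_rfl
  obtain rfl : b = b' := congrArg Prod.snd (Option.some_injective _ (hg.symm.trans hg'))
  exact hb'

theorem computable_codewordOutput {g : α → ℕ → Option (ℕ × β)} (hg : Computable₂ g) :
    Computable fun z : (List Bool × α) × ℕ => codewordOutput (g z.1.2) z.1.1 z.2 := by
  have hlengths : Computable₂ fun (z : (List Bool × α) × ℕ) j => (g z.1.2 j).map Prod.fst :=
    Computable.option_map (hg.comp (Computable.snd.comp (Computable.fst.comp Computable.fst))
      Computable.snd) (Computable.fst.comp Computable.snd).to₂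
  have hindex : Computable fun z : (List Bool × α) × ℕ =>
      codeIndex (fun j => (g z.1.2 j).map Prod.fst) z.2 z.1.1.length :=
    computable_codeIndex hlengths Computable.snd
      (Computable.list_length.comp (Computable.fst.comp Computable.fst))
  have hvalue : Computable fun z : (List Bool × α) × ℕ => natOfBits z.1.1.reverse :=
    computable_natOfBits.comp (Computable.list_reverse.comp (Computable.fst.comp Computable.fst))
  have hlength : Computable fun y : ((List Bool × α) × ℕ) × ℕ × β => y.2.1 == y.1.1.1.length :=
    Primrec.beq.to_comp.comp (Computable.fst.comp Computable.snd)
      (Computable.list_length.comp (Computable.fst.comp (Computable.fst.comp Computable.fst)))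
  have hcode : Computable fun y : ((List Bool × α) × ℕ) × ℕ × β =>
      codeIndex (fun j => (g y.1.1.2 j).map Prod.fst) y.1.2 y.1.1.1.length ==
        natOfBits y.1.1.1.reverse :=
    Primrec.beq.to_comp.comp (hindex.comp Computable.fst) (hvalue.comp Computable.fst)
  have houtput : Computable fun y : ((List Bool × α) × ℕ) × ℕ × β => some y.2.2 :=
    Computable.option_some.comp (Computable.snd.comp Computable.snd)
  exact Computable.option_bind (hg.comp (Computable.snd.comp Computable.fst) Computable.snd)
    (Computable.cond (Primrec.and.to_comp.comp hlength hcode) houtput (Computable.const none)).to₂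

/-- A version of the Kraft–Chaitin theorem. The factor `2` is the price of the Shannon–Fano–Elias
code, which assigns the codewords online. -/
theorem exists_isSelfDelimiting_of_kraftSum_le {g : α → ℕ → Option (ℕ × β)} (hg : Computable₂ g) :
    ∃ V : List Bool → α →. β, IsSelfDelimiting V ∧ ∀ {a i n b}, g a i = some (n, b) →
      2 * kraftSum (fun j => (g a j).map Prod.fst) (i + 1) ≤ 1 →
      ∃ q : List Bool, q.length = n ∧ b ∈ V q a := by
  refine ⟨fun q a => Nat.rfindOpt (codewordOutput (g a) q),
    ⟨Partrec.rfindOpt (computable_codewordOutput hg).to₂, ?_⟩, ?_⟩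
  · intro a q q' hq hq' hqq'
    obtain ⟨b, hb⟩ := Part.dom_iff_mem.1 hq
    obtain ⟨b', hb'⟩ := Part.dom_iff_mem.1 hq'
    obtain ⟨i, hg, hi⟩ := mem_rfindOpt_codewordOutput.1 hb
    obtain ⟨i', hg', hi'⟩ := mem_rfindOpt_codewordOutput.1 hb'
    obtain rfl := hi.index_eq_of_prefix hi' hqq'
    exact hqq'.eq_of_length (congrArg Prod.fst (Option.some_injective _ (hg.symm.trans hg')))
  · intro a i n b hb hsum
    have hℓ : (g a i).map Prod.fst = some n := congrArg (Option.map Prod.fst) hb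
    obtain ⟨q, rfl, hq⟩ := exists_isCodeword hℓ hsum
    exact ⟨q, rfl, mem_rfindOpt_codewordOutput.2 ⟨i, hb, hq⟩⟩

/-! ### Prefix complexity relative to a clock -/

theorem kraftSum_comp_le {ℓ : ℕ → Option ℕ} {M : ℕ} {ε : ℝ}
    (hM : ∀ u : Finset ℕ, (∀ n ∈ u, M ≤ n) → ∑ n ∈ u, kraftWeight (ℓ n) ≤ ε) {s : ℕ → ℕ} {i : ℕ}
    (hs : ∀ j < i, M ≤ s j) (hinj : Set.InjOn s (Finset.range i)) :
    kraftSum (ℓ ∘ s) i ≤ ε := by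
  have h := hM ((Finset.range i).image s) (by simpa using hs)
  rwa [Finset.sum_image hinj] at h

theorem two_mul_kraftSum_map_sub_le_one {ℓ : ℕ → Option ℕ} {k i : ℕ}
    (hsum : 2 * kraftSum ℓ i ≤ (1 / 2) ^ k) :
    2 * kraftSum (fun j => (ℓ j).map (· - k)) i ≤ 1 := by
  have hweight (n : ℕ) : ((1 : ℝ) / 2) ^ (n - k) ≤ 2 ^ k * (1 / 2) ^ n := by
    rw [one_div, inv_pow, inv_pow, inv_le_iff_one_le_mul₀ (by positivity), mul_right_comm,
      ← div_eq_mul_inv, one_le_div (by positivity), ← pow_add]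
    exact pow_le_pow_right₀ one_le_two (by omega)
  have hle : kraftSum (fun j => (ℓ j).map (· - k)) i ≤ 2 ^ k * kraftSum ℓ i := by
    rw [kraftSum, kraftSum, Finset.mul_sum]
    refine Finset.sum_le_sum fun j _ => ?_
    rcases ℓ j with _ | n
    · simp [kraftWeight]
    · exact hweight n
  calc 2 * kraftSum (fun j => (ℓ j).map (· - k)) i
      ≤ 2 ^ k * (2 * kraftSum ℓ i) := by linarith
    _ ≤ 2 ^ k * (1 / 2) ^ k := by gcongr
    _ = 1 := by rw [← mul_pow]; norm_num

theorem le_of_two_mul_kraftSum_le {ℓ : ℕ → Option ℕ} {i n k : ℕ} (hi : ℓ i = some n)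
    (hsum : 2 * kraftSum ℓ (i + 1) ≤ (1 / 2) ^ k) : k ≤ n := by
  have hle : kraftWeight (ℓ i) ≤ kraftSum ℓ (i + 1) :=
    Finset.single_le_sum (f := fun j => kraftWeight (ℓ j)) (fun _ _ => kraftWeight_nonneg _)
      (Finset.self_mem_range_succ i)
  have hweight : kraftWeight (ℓ i) ≤ (1 / 2) ^ k := by linarith [kraftWeight_nonneg (ℓ i)]
  rw [hi] at hweight
  exact (pow_le_pow_iff_right_of_lt_one₀ (by norm_num) (by norm_num)).1 hweight

theorem IsSelfDelimiting.exists_unary_header {V : List Bool → ℕ × α →. β}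
    (hV : IsSelfDelimiting V) :
    ∃ X : List Bool → α →. β, IsSelfDelimiting X ∧
      ∀ {p n a b}, b ∈ V p (n, a) → ∃ q, q.length = n + 1 + p.length ∧ b ∈ X q a := by
  obtain ⟨X, hX, hcomp⟩ := (isSelfDelimiting_unaryMachine.bind
    (f := fun (a : α) (n : ℕ) => Part.some (n, a)) (Computable.snd.pair Computable.fst)).exists_comp
      hV
  refine ⟨X, hX, fun {p n a b} hb => ?_⟩
  obtain ⟨h, hh, hn⟩ := exists_mem_unaryMachine n
  exact ⟨h ++ p, by rw [List.length_append, hh],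
    hcomp (Part.mem_bind_iff.2 ⟨n, Part.mem_coe.2 hn, Part.mem_some _⟩) hb⟩

theorem IsSelfDelimiting.exists_summable_enumeration {V : List Bool → α →. β}
    (hV : IsSelfDelimiting V) (a : α) :
    ∃ e : ℕ → Option (List Bool), Computable e ∧ (∀ p, (V p a).Dom → ∃ n, e n = some p) ∧
      Summable fun n => kraftWeight ((e n).map List.length) := by
  obtain ⟨e, he, hdom, hinj⟩ := exists_computable_enumeration
    (hV.partrec.comp Computable.id (Computable.const a))
  exact ⟨e, he, fun p => (hdom p).1, summable_kraftWeight hinj fun m n p q hp hq =>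
    hV.prefix_free a p q ((hdom p).2 ⟨m, hp⟩) ((hdom q).2 ⟨n, hq⟩)⟩

theorem exists_forall_le_index {δ : Type*} (e : ℕ → Option (List δ)) (M : ℕ) :
    ∃ N, ∀ {n p}, e n = some p → N ≤ p.length → M ≤ n := by
  refine ⟨∑ n ∈ Finset.range M, ((e n).getD []).length + 1, fun {n p} hn hp => ?_⟩
  by_contra hnM
  have hle := Finset.single_le_sum (f := fun n => ((e n).getD []).length)
    (fun _ _ => Nat.zero_le _) (Finset.mem_range.2 (not_le.1 hnM))
  simp only [hn, Option.getD_some] at hle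
  omega

theorem condK_le {U : List Bool → List Bool →. List Bool} {p x y : List Bool} (h : x ∈ U p y) :
    condK U x y ≤ p.length :=
  Nat.sInf_le ⟨p, rfl, h⟩

namespace IsUniversalPrefixMachine

variable {U : List Bool → List Bool →. List Bool}

theorem isSelfDelimiting (hU : IsUniversalPrefixMachine U) : IsSelfDelimiting U :=
  hU.isPrefixMachine.isSelfDelimiting

theorem exists_program (hU : IsUniversalPrefixMachine U) (x y : List Bool) :
    ∃ p, p.length = condK U x y ∧ x ∈ U p y := by
  let decode (_ : List Bool) (n : ℕ) : Part (List Bool) :=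
    ((Encodable.decode n : Option (List Bool)) : Part (List Bool))
  have hdecode : Partrec₂ decode := Computable.ofOption (Computable.decode.comp Computable.snd)
  obtain ⟨c, hc⟩ := hU.universal _ (isSelfDelimiting_unaryMachine.bind hdecode).isPrefixMachine
  obtain ⟨p, -, hp⟩ := exists_mem_unaryMachine (Encodable.encode x)
  have hx : x ∈ (unaryMachine p : Part ℕ).bind (decode y) :=
    Part.mem_bind_iff.2 ⟨_, Part.mem_coe.2 hp, Part.mem_coe.2 (Encodable.encodek x)⟩
  obtain ⟨q, -, hq⟩ := hc p y x hx
  exact Nat.sInf_mem (s := {n | ∃ p : List Bool, p.length = n ∧ x ∈ U p y}) ⟨_, q, rfl, hq⟩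

theorem exists_condK_le (hU : IsUniversalPrefixMachine U)
    {V : List Bool → List Bool →. List Bool} (hV : IsSelfDelimiting V) :
    ∃ c, ∀ {p x y}, x ∈ V p y → condK U x y ≤ p.length + c := by
  obtain ⟨c, hc⟩ := hU.universal V hV.isPrefixMachine
  refine ⟨c, fun {p x y} h => ?_⟩
  obtain ⟨q, hq, hx⟩ := hc p y x h
  exact (condK_le hx).trans hq

theorem exists_condK_le_prefixK (hU : IsUniversalPrefixMachine U) :
    ∃ c, ∀ x y, condK U x y ≤ prefixK U x + c := by
  obtain ⟨c, hc⟩ := hU.exists_condK_le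
    (hU.isSelfDelimiting.comap (f := fun _ : List Bool => Part.some []) (Computable.const []))
  refine ⟨c, fun x y => ?_⟩
  obtain ⟨p, hp, hx⟩ := hU.exists_program x []
  rw [prefixK, ← hp]
  exact hc (Part.mem_bind_iff.2 ⟨[], Part.mem_some _, hx⟩)

theorem exists_condK_le_add (hU : IsUniversalPrefixMachine U) :
    ∃ c, ∀ x y z, condK U z x ≤ condK U y x + condK U z y + c := by
  obtain ⟨X, hX, hcomp⟩ := hU.isSelfDelimiting.exists_comp hU.isSelfDelimiting
  obtain ⟨c, hc⟩ := hU.exists_condK_le hX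
  refine ⟨c, fun x y z => ?_⟩
  obtain ⟨p, hp, hy⟩ := hU.exists_program y x
  obtain ⟨q, hq, hz⟩ := hU.exists_program z y
  rw [← hp, ← hq, ← List.length_append]
  exact hc (hcomp hy hz)

theorem exists_condK_add_le (hU : IsUniversalPrefixMachine U)
    {g : List Bool → ℕ → Option (List Bool)} (hg : Computable₂ g) :
    ∃ c, ∀ {x y p i L}, g y i = some p → x ∈ U p [] →
      2 * kraftSum (fun j => (g y j).map List.length) (i + 1) ≤ (1 / 2) ^ (2 * L) →
      condK U x y + L ≤ p.length + c := by
  -- A program is a header for `L`, of length `L + 1`, and a codeword `2 * L` bits shorter than `p`.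
  let request (z : ℕ × List Bool) (j : ℕ) : Option (ℕ × List Bool) :=
    (g z.2 j).map fun p => (p.length - 2 * z.1, p)
  have hrequest : Computable₂ request := by
    have hg' : Computable fun y : (ℕ × List Bool) × ℕ => g y.1.2 y.2 :=
      hg.comp (Computable.snd.comp Computable.fst) Computable.snd
    have hdouble : Computable fun y : ((ℕ × List Bool) × ℕ) × List Bool => 2 * y.1.1.1 :=
      Primrec.nat_mul.to_comp.comp (Computable.const 2)
        (Computable.fst.comp (Computable.fst.comp Computable.fst))
    exact Computable.option_map hg' ((Primrec.nat_sub.to_comp.comp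
      (Computable.list_length.comp Computable.snd) hdouble).pair Computable.snd).to₂
  obtain ⟨W, hW, hcode⟩ := exists_isSelfDelimiting_of_kraftSum_le hrequest
  have hrun : Partrec₂ fun (_ : ℕ × List Bool) (p : List Bool) => U p [] :=
    hU.isPrefixMachine.partrec.comp Computable.snd (Computable.const [])
  obtain ⟨X, hX, hheader⟩ := (hW.bind hrun).exists_unary_header
  obtain ⟨c, hc⟩ := hU.exists_condK_le hX
  refine ⟨c + 1, fun {x y p i L} hp hx hsum => ?_⟩
  have hL : 2 * L ≤ p.length :=
    le_of_two_mul_kraftSum_le (ℓ := fun j => (g y j).map List.length) (by simp [hp]) hsum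
  have hrequest_sum : 2 * kraftSum (fun j => (request (L, y) j).map Prod.fst) (i + 1) ≤ 1 := by
    simpa only [request, Option.map_map, Function.comp_def] using
      two_mul_kraftSum_map_sub_le_one hsum
  obtain ⟨q, hq, hqW⟩ := hcode (congrArg (Option.map _) hp) hrequest_sum
  obtain ⟨r, hr, hrX⟩ := hheader (Part.mem_bind_iff.2 ⟨p, hqW, hx⟩)
  have hle := hc hrX
  omega

/-- The condition `y` serves as a clock: few programs halt long after time `y`, and few halt before
time `y` but late. -/
theorem exists_finite_condK_add_lt_prefixK (hU : IsUniversalPrefixMachine U) (c₀ : ℕ) :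
    ∃ T : Set (List Bool), T.Finite ∧ ∃ N : ℕ, ∀ x y, y ∉ T → N ≤ prefixK U x →
      condK U x y + c₀ < prefixK U x := by
  obtain ⟨e, he, hdom, hsum⟩ := hU.isSelfDelimiting.exists_summable_enumeration []
  have hencode : Computable fun z : List Bool × ℕ => Encodable.encode z.1 :=
    Computable.encode.comp Computable.fst
  obtain ⟨c₁, hlate⟩ := hU.exists_condK_add_le (g := fun y j => e (Encodable.encode y + j))
    (he.comp (Primrec.nat_add.to_comp.comp hencode Computable.snd))
  obtain ⟨c₂, hearly⟩ := hU.exists_condK_add_le (g := fun y j => e (Encodable.encode y - (j + 1)))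
    (he.comp (Primrec.nat_sub.to_comp.comp hencode (Computable.succ.comp Computable.snd)))
  let L := c₀ + c₁ + c₂ + 1
  obtain ⟨M, hM⟩ := exists_sum_le_of_summable hsum (ε := (1 / 2) ^ (2 * L) / 2) (by positivity)
  obtain ⟨N, hN⟩ := exists_forall_le_index e M
  refine ⟨{y | Encodable.encode y < M},
    (Set.finite_Iio M).preimage Encodable.encode_injective.injOn, N, fun x y hy hx => ?_⟩
  have hM_le : M ≤ Encodable.encode y := not_lt.1 hy
  obtain ⟨p, hp, hxp⟩ := hU.exists_program x []
  obtain ⟨n, hn⟩ := hdom p hxp.1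
  rw [prefixK, ← hp] at hx ⊢
  have hMn : M ≤ n := hN hn hx
  have hsmall {s : ℕ → ℕ} {i : ℕ} (hs : ∀ j < i, M ≤ s j) (hinj : Set.InjOn s (Finset.range i)) :
      2 * kraftSum ((fun n => (e n).map List.length) ∘ s) i ≤ (1 / 2) ^ (2 * L) := by
    linarith [kraftSum_comp_le hM hs hinj]
  suffices h : condK U x y + L ≤ p.length + c₁ ∨ condK U x y + L ≤ p.length + c₂ by omega
  rcases le_or_gt (Encodable.encode y) n with hyn | hny
  · refine .inl (hlate (i := n - Encodable.encode y) ?_ hxp (hsmall ?_ ?_))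
    · rwa [Nat.add_sub_cancel' hyn]
    · exact fun j _ => by omega
    · exact fun a _ b _ hab => Nat.add_left_cancel hab
  · refine .inr (hearly (i := Encodable.encode y - 1 - n) ?_ hxp (hsmall ?_ ?_))
    · rwa [show Encodable.encode y - (Encodable.encode y - 1 - n + 1) = n by omega]
    · exact fun j _ => by omega
    · intro a ha b hb hab
      simp only [Finset.coe_range, Set.mem_Iio] at ha hb hab
      omega

end IsUniversalPrefixMachine

/-! ### Simulation of adaptation processes -/

/-- The result of one step of a bit reader with states in `α`: an output, a next state, or the pair
of next states from which one bit of the program chooses. -/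
abbrev BitStep (α β : Type*) : Type _ := β ⊕ α ⊕ α × α

/-- What a bit reader does after a step, when the bits `w` are still unread. An output is accepted
only if all the bits have been read. -/
def BitStep.advance : BitStep α β → List Bool → Option (β ⊕ α × List Bool)
  | Sum.inl b, w => bif w.isEmpty then some (Sum.inl b) else none
  | Sum.inr (Sum.inl a), w => some (Sum.inr (a, w))
  | Sum.inr (Sum.inr (a₀, a₁)), w => w.head?.map fun c => Sum.inr (bif c then a₁ else a₀, w.tail)

/-- One step of the bit reader, on a state and the unread bits. -/
def bitReaderStep (step : α →. BitStep α β) (x : α × List Bool) : Part (β ⊕ α × List Bool) :=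
  (step x.1).bind fun o => (o.advance x.2 : Part _)

/-- The machine that iterates `step`, branching according to the bits of its program. -/
def bitReader (step : α →. BitStep α β) (w : List Bool) (a : α) : Part β :=
  PFun.fix (bitReaderStep step) (a, w)

theorem BitStep.computable_advance : Computable₂ (advance : BitStep α β → _) := by
  have haccept : Computable fun y : (BitStep α β × List Bool) × β =>
      bif y.1.2.isEmpty then some (Sum.inl (β := α × List Bool) y.2) else none :=
    Computable.cond
      ((Primrec.beq.to_comp.comp (Computable.list_length.comp (Computable.snd.comp Computable.fst))
        (Computable.const 0)).of_eq fun y => by cases y.1.2 <;> rfl)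
      (Computable.option_some.comp (Computable.sumInl.comp Computable.snd)) (Computable.const none)
  have hmove : Computable fun y : ((BitStep α β × List Bool) × (α ⊕ α × α)) × α =>
      some (Sum.inr (α := β) (y.2, y.1.1.2)) :=
    Computable.option_some.comp (Computable.sumInr.comp (Computable.snd.pair
      (Computable.snd.comp (Computable.fst.comp Computable.fst))))
  have hbranch : Computable fun y : ((BitStep α β × List Bool) × (α ⊕ α × α)) × α × α =>
      y.1.1.2.head?.map fun c => Sum.inr (α := β) (bif c then y.2.2 else y.2.1, y.1.1.2.tail) := by
    have hbits : Computable fun y : ((BitStep α β × List Bool) × (α ⊕ α × α)) × α × α =>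
        y.1.1.2 := Computable.snd.comp (Computable.fst.comp Computable.fst)
    have hstates : Computable fun y : (((BitStep α β × List Bool) × (α ⊕ α × α)) × α × α) ×
        Bool => y.1.2 := Computable.snd.comp Computable.fst
    exact Computable.option_map (Primrec.list_head?.to_comp.comp hbits)
      (Computable.sumInr.comp ((Computable.cond Computable.snd (Computable.snd.comp hstates)
        (Computable.fst.comp hstates)).pair
          (Primrec.list_tail.to_comp.comp (hbits.comp Computable.fst)))).to₂
  refine (Computable.sumCasesOn Computable.fst haccept.to₂
    (Computable.sumCasesOn Computable.snd hmove.to₂ hbranch.to₂).to₂).of_eq ?_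
  rintro ⟨_ | _ | _, w⟩ <;> rfl

section

variable {α β : Type*} {step : α →. BitStep α β}

theorem mem_bitReaderStep {x : α × List Bool} {r : β ⊕ α × List Bool} :
    r ∈ bitReaderStep step x ↔ ∃ o ∈ step x.1, o.advance x.2 = some r := by
  simp only [bitReaderStep, Part.mem_bind_iff, Part.mem_coe, Option.mem_def]

theorem BitStep.advance_append {o : BitStep α β} {w : List Bool} {x : α × List Bool}
    (h : o.advance w = some (Sum.inr x)) (v : List Bool) :
    o.advance (w ++ v) = some (Sum.inr (x.1, x.2 ++ v)) := by
  rcases o with b | a | ⟨a₀, a₁⟩ <;> rcases w with _ | ⟨c, w⟩ <;> simp_all [BitStep.advance] <;>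
    simp [← h]

theorem BitStep.eq_nil_of_advance_eq_inl {o : BitStep α β} {w v : List Bool} {b : β}
    {r : β ⊕ α × List Bool} (h : o.advance w = some (Sum.inl b))
    (hv : o.advance (w ++ v) = some r) : v = [] := by
  rcases o with b | a | ⟨a₀, a₁⟩ <;> rcases w with _ | ⟨c, w⟩ <;> rcases v with _ | ⟨c', v⟩ <;>
    simp_all [BitStep.advance]

theorem eq_nil_of_mem_bitReader_append {w v : List Bool} {a : α} {b b' : β}
    (hb : b ∈ bitReader step w a) (hb' : b' ∈ bitReader step (w ++ v) a) : v = [] := by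
  refine PFun.fixInduction' (C := fun x => b' ∈ bitReader step (x.2 ++ v) x.1 → v = []) hb
    (fun x hx hb' => ?_) (fun x x' _ hx ih hb' => ?_) hb'
  · obtain ⟨r, hr⟩ := Part.dom_iff_mem.1 (PFun.dom_of_mem_fix hb')
    obtain ⟨o, ho, hadvance⟩ := mem_bitReaderStep.1 hx
    obtain ⟨o', ho', hadvance'⟩ := mem_bitReaderStep.1 hr
    obtain rfl := Part.mem_unique ho ho'
    exact BitStep.eq_nil_of_advance_eq_inl hadvance hadvance'
  · obtain ⟨o, ho, hadvance⟩ := mem_bitReaderStep.1 hx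
    exact ih (PFun.fix_fwd hb' (mem_bitReaderStep.2 ⟨o, ho, BitStep.advance_append hadvance v⟩))

theorem mem_bitReader_of_halt {a : α} {b : β} (h : Sum.inl b ∈ step a) :
    b ∈ bitReader step [] a :=
  PFun.fix_stop (mem_bitReaderStep.2 ⟨_, h, rfl⟩)

theorem mem_bitReader_of_move {a a' : α} {b : β} {w : List Bool}
    (h : Sum.inr (Sum.inl a') ∈ step a) (hb : b ∈ bitReader step w a') : b ∈ bitReader step w a :=
  PFun.mem_fix_iff.2 (.inr ⟨(a', w), mem_bitReaderStep.2 ⟨_, h, rfl⟩, hb⟩)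

theorem mem_bitReader_of_branch {a a₀ a₁ : α} {b : β} {c : Bool} {w : List Bool}
    (h : Sum.inr (Sum.inr (a₀, a₁)) ∈ step a)
    (hb : b ∈ bitReader step w (bif c then a₁ else a₀)) : b ∈ bitReader step (c :: w) a :=
  PFun.mem_fix_iff.2 (.inr ⟨(bif c then a₁ else a₀, w), mem_bitReaderStep.2 ⟨_, h, rfl⟩, hb⟩)

end

theorem isSelfDelimiting_bitReader {step : α →. BitStep α β} (hstep : Partrec step) :
    IsSelfDelimiting (bitReader step) where
  partrec := by
    have hnext : Partrec (bitReaderStep step) :=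
      (hstep.comp Computable.fst).bind (Computable.ofOption
        (BitStep.computable_advance.comp Computable.snd (Computable.snd.comp Computable.fst))).to₂
    exact hnext.fix.comp (Computable.snd.pair Computable.fst)
  prefix_free a p q hp hq hpq := by
    obtain ⟨v, rfl⟩ := hpq
    obtain ⟨b, hb⟩ := Part.dom_iff_mem.1 hp
    obtain ⟨b', hb'⟩ := Part.dom_iff_mem.1 hq
    rw [eq_nil_of_mem_bitReader_append hb hb', List.append_nil]

/-- The program with the given source code, inverse to `AdaptationProcess.desc`. -/
def codeOfBits (d : List Bool) : Code := Denumerable.ofNat Code (natOfBits d)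

theorem computable_codeOfBits : Computable codeOfBits :=
  (Computable.ofNat Code).comp computable_natOfBits

theorem AdaptationProcess.codeOfBits_desc (P : AdaptationProcess) :
    codeOfBits P.desc = P.code := by
  rw [codeOfBits, AdaptationProcess.desc, natOfBits_bits, Denumerable.ofNat_encode]

theorem computable_overwrite {s : α → Config} {k : α → Cell} {b : α → Bool} (hs : Computable s)
    (hk : Computable k) (hb : Computable b) :
    Computable fun a => (s a).overwrite (k a) (b a) := by
  have hq : Computable fun z : α × ℕ => (s z.1).1 :=
    Computable.fst.comp (hs.comp Computable.fst)
  have hS : Computable fun z : α × ℕ => (s z.1).2.1 :=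
    Computable.fst.comp (Computable.snd.comp (hs.comp Computable.fst))
  have hW : Computable fun z : α × ℕ => (s z.1).2.2 :=
    Computable.snd.comp (Computable.snd.comp (hs.comp Computable.fst))
  have hset {x : α × ℕ → List Bool} (hx : Computable x) :
      Computable fun z => (x z).set z.2 (b z.1) :=
    Primrec.list_set.to_comp.comp hx (Computable.snd.pair (hb.comp Computable.fst))
  refine (Computable.sumCasesOn hk (hq.pair ((hset hS).pair hW)).to₂
    (hq.pair (hS.pair (hset hW))).to₂).of_eq fun a => ?_
  cases hka : k a <;> simp only [Config.overwrite]

/-- The one-step behaviour `(halted, next, erased)` in the configuration `s` according to the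
program `c`, as in `AdaptationProcess.code_eval`. -/
def stepBehaviour (c : Code) (s : Config) : Part (Bool × Config × Option Cell) :=
  (c.eval (Encodable.encode s)).bind fun v =>
    ((Encodable.decode v : Option (Bool × Config × Option Cell)) : Part _)

theorem partrec_stepBehaviour : Partrec₂ stepBehaviour :=
  (Code.eval_part.comp Computable.fst (Computable.encode.comp Computable.snd)).bind
    (Computable.ofOption (Computable.decode.comp Computable.snd)).to₂

theorem AdaptationProcess.stepBehaviour_code (P : AdaptationProcess) (s : Config) :
    stepBehaviour P.code s = Part.some (P.halted s, P.next s, P.erased s) := by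
  rw [stepBehaviour, P.code_eval, Part.bind_some, Encodable.encodek]
  rfl

/-- The step of a process with program `c` in the configuration `s`, given whether `s` is halted,
the next configuration and the cell that is then erased. An erasure branches on the new content. -/
def branchOnErasure (c : Code) (s : Config) (h : Bool) (n : Config) (k : Option Cell) :
    BitStep (Code × Config) (List Bool) :=
  bif h then Sum.inl s.2.1 else Sum.inr (k.elim (Sum.inl (c, n)) fun k =>
    Sum.inr ((c, n.overwrite k false), (c, n.overwrite k true)))

theorem computable_branchOnErasure {c : α → Code} {s n : α → Config} {h : α → Bool}
    {k : α → Option Cell} (hc : Computable c) (hs : Computable s) (hh : Computable h)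
    (hn : Computable n) (hk : Computable k) :
    Computable fun a => branchOnErasure (c a) (s a) (h a) (n a) (k a) := by
  have hwrite (b : Bool) : Computable fun z : α × Cell => (c z.1, (n z.1).overwrite z.2 b) :=
    (hc.comp Computable.fst).pair
      (computable_overwrite (hn.comp Computable.fst) Computable.snd (Computable.const b))
  have hmove := (Computable.option_casesOn hk (Computable.sumInl.comp (hc.pair hn))
    (Computable.sumInr.comp ((hwrite false).pair (hwrite true))).to₂)
  refine (Computable.cond hh (Computable.sumInl.comp (Computable.fst.comp (Computable.snd.comp hs)))
    (Computable.sumInr.comp hmove)).of_eq fun a => ?_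
  rw [branchOnErasure]
  cases k a <;> rfl

/-- One step of the process with program `x.1` in the configuration `x.2`, for the bit reader. The
cell that is erased is determined by the configuration `next`. -/
def processStep (x : Code × Config) :
    Part (BitStep (Code × Config) (List Bool)) :=
  (stepBehaviour x.1 x.2).bind fun o => (stepBehaviour x.1 o.2.1).map fun o' =>
    branchOnErasure x.1 x.2 o.1 o.2.1 o'.2.2

theorem partrec_processStep : Partrec processStep := by
  have hnext : Partrec fun y : (Code × Config) × Bool × Config × Option Cell =>
      stepBehaviour y.1.1 y.2.2.1 :=
    partrec_stepBehaviour.comp (Computable.fst.comp Computable.fst)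
      (Computable.fst.comp (Computable.snd.comp Computable.snd))
  have hbranch : Computable fun y : ((Code × Config) × Bool × Config × Option Cell) ×
      Bool × Config × Option Cell =>
      branchOnErasure y.1.1.1 y.1.1.2 y.1.2.1 y.1.2.2.1 y.2.2.2 :=
    computable_branchOnErasure (Computable.fst.comp (Computable.fst.comp Computable.fst))
      (Computable.snd.comp (Computable.fst.comp Computable.fst))
      (Computable.fst.comp (Computable.snd.comp Computable.fst))
      (Computable.fst.comp (Computable.snd.comp (Computable.snd.comp Computable.fst)))
      (Computable.snd.comp (Computable.snd.comp Computable.snd))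
  exact partrec_stepBehaviour.bind (hnext.map hbranch.to₂).to₂

theorem AdaptationProcess.processStep_code (P : AdaptationProcess) (s : Config) :
    processStep (P.code, s) =
      Part.some (branchOnErasure P.code s (P.halted s) (P.next s) (P.erased (P.next s))) := by
  simp only [processStep, P.stepBehaviour_code, Part.bind_some, Part.map_some]

/-- The machine that runs a process on the initial contents of its substrate and its memory and
outputs the final content of the substrate. The condition consists of the description of the
process and of these two contents, the program of the bits written by the erasures. -/
def processMachine (w : List Bool) (x : List Bool × List Bool × List Bool) : Part (List Bool) :=
  bitReader processStep w (codeOfBits x.1, (0, x.2))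

theorem isSelfDelimiting_processMachine : IsSelfDelimiting processMachine := by
  have hinit : Computable fun x : List Bool × List Bool × List Bool =>
      (codeOfBits x.1, ((0, x.2) : Config)) :=
    (computable_codeOfBits.comp Computable.fst).pair ((Computable.const 0).pair Computable.snd)
  have h := (isSelfDelimiting_bitReader partrec_processStep).comap hinit.partrec
  simp only [PFun.coe_val, Part.bind_some] at h
  exact h

theorem AdaptationProcess.Run.exists_mem_bitReader {P : AdaptationProcess} {s t : Config} {H : ℕ}
    (h : P.Run s H t) :
    ∃ w : List Bool, w.length = H ∧ t.2.1 ∈ bitReader processStep w (P.code, s) := by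
  induction h with
  | halt s hs =>
    exact ⟨[], rfl, mem_bitReader_of_halt (by simp [P.processStep_code, branchOnErasure, hs])⟩
  | reversible s H t hs hk _ ih =>
    obtain ⟨w, hw, ht⟩ := ih
    exact ⟨w, hw, mem_bitReader_of_move
      (by simp [P.processStep_code, branchOnErasure, hs, hk]) ht⟩
  | erase s k b H t hs hk _ ih =>
    obtain ⟨w, hw, ht⟩ := ih
    refine ⟨b :: w, by rw [List.length_cons, hw], mem_bitReader_of_branch
      (a₀ := (P.code, (P.next s).overwrite k false)) (a₁ := (P.code, (P.next s).overwrite k true))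
      (by simp [P.processStep_code, branchOnErasure, hs, hk]) ?_⟩
    cases b <;> exact ht

theorem AdaptationProcess.Run.exists_mem_processMachine {P : AdaptationProcess}
    {S₀ D S W : List Bool} {q H : ℕ} (h : P.Run (0, S₀, D) H (q, S, W)) :
    ∃ w : List Bool, w.length = H ∧ S ∈ processMachine w (P.desc, S₀, D) := by
  simpa only [processMachine, P.codeOfBits_desc] using h.exists_mem_bitReader

theorem IsUniversalPrefixMachine.exists_condK_le_length_add {U : List Bool → List Bool →. List Bool}
    (hU : IsUniversalPrefixMachine U) {V : List Bool → List Bool × α × List Bool →. List Bool}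
    (hV : IsSelfDelimiting V) {T : Set α} (hT : T.Finite) (c₁ : ℕ) :
    ∃ c, ∀ {w d a y x}, a ∈ T → condK U d y ≤ c₁ → x ∈ V w (d, a, y) →
      condK U x y ≤ w.length + c := by
  have hfix (z : List Bool × α) : IsSelfDelimiting fun w y =>
      ((U z.1 y).map fun d => (d, z.2, y)).bind (V w) :=
    hV.comap ((hU.isPrefixMachine.partrec.comp (Computable.const z.1) Computable.id).map
      (Computable.snd.pair ((Computable.const z.2).pair Computable.fst)).to₂)
  choose c hc using fun z => hU.exists_condK_le (hfix z)
  obtain ⟨C, hC⟩ := (((List.finite_length_le Bool c₁).prod hT).image c).bddAbove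
  refine ⟨C, fun {w d a y x} ha hd hx => ?_⟩
  obtain ⟨r, hr, hrd⟩ := hU.exists_program d y
  have hcC : c (r, a) ≤ C := hC ⟨(r, a), ⟨hr.trans_le hd, ha⟩, rfl⟩
  exact (hc (r, a) (Part.mem_bind_iff.2 ⟨_, Part.mem_map _ hrd, hx⟩)).trans (by omega)

theorem lemma2_general {U : List Bool → List Bool →. List Bool} (hU : IsUniversalPrefixMachine U)
    {V : List Bool → List Bool × List Bool × List Bool →. List Bool} (hV : IsSelfDelimiting V)
    (c₀ c₁ : ℕ) :
    ∃ c_U : ℕ, ∀ {w d σ S₀ D S : List Bool}, prefixK U σ ≤ condK U σ S₀ + c₀ →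
      condK U d D ≤ c₁ → S ∈ V w (d, S₀, D) →
      (w.length : ℤ) ≥ algMutualInfo U S σ - algMutualInfo U D σ - (c_U : ℤ) := by
  obtain ⟨T, hT, N, hclock⟩ := hU.exists_finite_condK_add_lt_prefixK c₀
  obtain ⟨b, hb⟩ := hU.exists_condK_le_length_add hV hT c₁
  obtain ⟨k, hk⟩ := hU.exists_condK_le_prefixK
  obtain ⟨m, hm⟩ := hU.exists_condK_le_add
  refine ⟨N + k + b + m, fun {w d σ S₀ D S} hσ hd hS => ?_⟩
  have hinfo : condK U σ D ≤ w.length + condK U σ S + (N + k + b + m) := by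
    rcases lt_or_ge (prefixK U σ) N with hsimple | hcomplex
    · have hσD := hk σ D
      omega
    · have hS₀ : S₀ ∈ T := by
        by_contra hS₀
        exact (hclock σ S₀ hS₀ hcomplex).not_ge hσ
      have hSD := hb hS₀ hd hS
      have hchain := hm D S σ
      omega
  rw [algMutualInfo, algMutualInfo]
  omega

theorem lemma2 (U : List Bool → List Bool →. List Bool) (hU : IsUniversalPrefixMachine U)
    (c₀ c₁ : ℕ) :
    ∃ c_U : ℕ, ∀ (P : AdaptationProcess) (σ S₀ D S W : List Bool) (q H : ℕ),
      |(condK U σ S₀ : ℤ) - (prefixK U σ : ℤ)| ≤ (c₀ : ℤ) →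
      condK U P.desc D ≤ c₁ →
      P.Run (0, S₀, D) H (q, S, W) →
      (H : ℤ) ≥ algMutualInfo U S σ - algMutualInfo U D σ - (c_U : ℤ) := by
  obtain ⟨c, hc⟩ := lemma2_general hU isSelfDelimiting_processMachine c₀ c₁
  refine ⟨c, fun P σ S₀ D S W q H hσ hP hrun => ?_⟩
  obtain ⟨w, rfl, hw⟩ := hrun.exists_mem_processMachine
  exact hc (by have := (abs_le.1 hσ).1; omega) hP hw
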